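/- Let $E$ be an elliptic curve over $\mathbb{Q}$, and fix an algebraic closure $\overline{\mathbb{Q}}$ of $\mathbb{Q}$. Then for all but finitely many quadratic extensions $K/\mathbb{Q}$ inside $\overline{\mathbb{Q}}$ (that is, subfields $K\subset\overline{\mathbb{Q}}$ with $[K:\mathbb{Q}]=2$), one has $E(K)_{\mathrm{tors}} = E(\mathbb{Q})_{\mathrm{tors}}$, where $E(F)_{\mathrm{tors}}$ is the torsion subgroup of the group $E(F)$ of $F$-rational points and $E(\mathbb{Q})$ is regarded as a subgroup of $E(K)$ through the natural inclusion. -/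

import Mathlib

open Classical in
/-- The natural inclusion `E(ℚ) → E(K)` of the groups of rational points of a Weierstrass curve
`E` over `ℚ`, for a field extension `K` of `ℚ`. -/
noncomputable def rationalPointInclusion (E : WeierstrassCurve ℚ) (K : Type*) [Field K]
    [Algebra ℚ K] : (E.baseChange ℚ).toAffine.Point →+ (E.baseChange K).toAffine.Point :=
  WeierstrassCurve.Affine.Point.map (Algebra.ofId ℚ K)

open Classical in
/-- `E(K)_tors = E(ℚ)_tors`: the torsion subgroup of `E(K)` is equal to the image of the torsion
subgroup of `E(ℚ)` under the natural inclusion `E(ℚ) → E(K)`. -/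
def SameTorsion (E : WeierstrassCurve ℚ) (K : Type*) [Field K] [Algebra ℚ K] : Prop :=
  AddCommGroup.torsion (E.baseChange K).toAffine.Point =
    (AddCommGroup.torsion (E.baseChange ℚ).toAffine.Point).map (rationalPointInclusion E K)

/-! A point `P` over a quadratic field, with conjugate `P'`, gives the rational point (x(P)x(P') :
x(P)+x(P') : 1) of Sym² ℙ¹ = ℙ². Doubling acts there through a map `dupMap` of degree 4 over ℚ
(`exists_dupMap_normTraceCoords_eq`), so h(2P) ≥ 4h(P) − C with C independent of the field. The
multiples of a torsion point form a finite set, which forces h ≤ C/3. Northcott over ℚ leaves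
finitely many norm-trace pairs, hence finitely many torsion points over all quadratic fields
together. A torsion point not defined over ℚ generates its field, so only finitely many fields
acquire new torsion. -/

open Polynomial in
/-- A Weierstrass curve has only finitely many affine points whose `x`-coordinate is a root of one
of finitely many monic quadratics. -/
lemma finite_setOf_quadratic_weierstrass {F : Type*} [Field F] (W : WeierstrassCurve.Affine F)
    (S : Set (F × F)) (hS : S.Finite) :
    {p : F × F | (∃ q ∈ S, p.1 ^ 2 - q.2 * p.1 + q.1 = 0) ∧ W.Equation p.1 p.2}.Finite := by
  have quadratic_finite (b c : F) : {x : F | x ^ 2 - b * x + c = 0}.Finite := by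
    have hp : (X ^ 2 - C b * X + C c : F[X]) ≠ 0 := by
      have : (X ^ 2 - C b * X + C c : F[X]).Monic := by monicity!
      exact this.ne_zero
    refine (Polynomial.finite_setOfPred_isRoot hp).subset fun x hx ↦ ?_
    simpa [IsRoot] using hx
  have hX : (⋃ q ∈ S, {x : F | x ^ 2 - q.2 * x + q.1 = 0}).Finite :=
    hS.biUnion fun q _ ↦ quadratic_finite _ _
  have hY := hX.biUnion fun x _ ↦
    (quadratic_finite (-(W.a₁ * x + W.a₃)) (-(x ^ 3 + W.a₂ * x ^ 2 + W.a₄ * x + W.a₆))).image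
      fun y ↦ (x, y)
  refine hY.subset ?_
  rintro ⟨x, y⟩ ⟨⟨q, hq, h⟩, hW⟩
  simp only [Set.mem_iUnion, Set.mem_image]
  refine ⟨x, ⟨q, hq, h⟩, y, ?_, rfl⟩
  rw [WeierstrassCurve.Affine.equation_iff] at hW
  change y ^ 2 - -(W.a₁ * x + W.a₃) * y + -(x ^ 3 + W.a₂ * x ^ 2 + W.a₄ * x + W.a₆) = 0
  linear_combination hW

namespace WeierstrassCurve

/-! ### Duplication formula and the sum-difference map. -/

section Duplication

variable {F : Type*} [Field F] (W : WeierstrassCurve F)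

/-- The numerator of the duplication formula for the `x`-coordinate. -/
def dupNum (x : F) : F := x ^ 4 - W.b₄ * x ^ 2 - 2 * W.b₆ * x - W.b₈

/-- The denominator of the duplication formula for the `x`-coordinate. -/
def dupDen (x : F) : F := 4 * x ^ 3 + W.b₂ * x ^ 2 + 2 * W.b₄ * x + W.b₆

/-- `addSubMap` describes {P, Q} ↦ {P + Q, P − Q} on x-coordinates; iterating it gives {2P, 2Q}, so
its square doubles each factor. -/
lemma addSubMap_addSubMap_sym2 (x x' : F) :
    (fun i ↦ (addSubMap W i).eval fun j ↦ (addSubMap W j).eval ![x * x', x + x', 1]) =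
      ![W.dupNum x * W.dupNum x', W.dupNum x * W.dupDen x' + W.dupDen x * W.dupNum x',
        W.dupDen x * W.dupDen x'] := by
  have h := W.b_relation
  ext i
  fin_cases i <;> simp [addSubMap, dupNum, dupDen] <;> grind only

lemma addSubMap_addSubMap_zero :
    (fun i ↦ (addSubMap W i).eval fun j ↦ (addSubMap W j).eval ![1, 0, 0]) =
      (![1, 0, 0] : Fin 3 → F) := by
  ext i
  fin_cases i <;> simp [addSubMap]

variable {W}

lemma dupDen_eq_sq {x y : F} (h : W.toAffine.Equation x y) :
    W.dupDen x = (y - W.toAffine.negY x y) ^ 2 := by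
  rw [Affine.equation_iff] at h
  simp only [dupDen, Affine.negY, b₂, b₄, b₆]
  linear_combination -4 * h

lemma dupNum_eq_dupDen_mul_addX {x y : F} [DecidableEq F] (h : W.toAffine.Equation x y)
    (hy : y ≠ W.toAffine.negY x y) :
    W.dupNum x = W.dupDen x * W.toAffine.addX x x (W.toAffine.slope x x y y) := by
  have hy' : y - W.toAffine.negY x y ≠ 0 := sub_ne_zero.mpr hy
  rw [dupDen_eq_sq h, Affine.slope_of_Y_ne rfl hy, Affine.addX]
  field_simp
  rw [Affine.equation_iff] at h
  simp only [dupNum, Affine.negY, b₄, b₆, b₈]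
  grind only

end Duplication

section NormTrace

/-- The norm and trace of a quadratic field are given by a pair of embeddings. -/
lemma exists_pair_embeddings (K : Type*) [Field K] [Algebra ℚ K]
    (hK : Module.finrank ℚ K = 2) :
    ∃ σ τ : K →ₐ[ℚ] AlgebraicClosure ℚ, ∀ x : K,
      algebraMap ℚ (AlgebraicClosure ℚ) (Algebra.norm ℚ x) = σ x * τ x ∧
        algebraMap ℚ (AlgebraicClosure ℚ) (Algebra.trace ℚ K x) = σ x + τ x := by
  have : FiniteDimensional ℚ K := .of_finrank_pos (by omega)
  classical
  have hcard : Fintype.card (K →ₐ[ℚ] AlgebraicClosure ℚ) = 2 := by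
    rw [AlgHom.card, hK]
  obtain ⟨σ, τ, hne, h⟩ := Finset.card_eq_two.mp (Finset.card_univ.trans hcard)
  refine ⟨σ, τ, fun x ↦ ⟨?_, ?_⟩⟩
  · rw [Algebra.norm_eq_prod_embeddings, h, Finset.prod_pair hne]
  · rw [trace_eq_sum_embeddings, h, Finset.sum_pair hne]

end NormTrace

/-! ### Doubling on the symmetric square of the x-line. -/

section SymmetricSquare

variable (E : WeierstrassCurve ℚ) {K : Type*} [Field K] [Algebra ℚ K]

/-- For a point `P` over a quadratic field `K` with conjugate `P'`, a vector of homogeneous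
coordinates of the rational point `(x(P) x(P') : x(P) + x(P') : 1)` of `ℙ²`. -/
noncomputable def normTraceCoords : (E.baseChange K).toAffine.Point → Fin 3 → ℚ
  | .zero => ![1, 0, 0]
  | .some x _ _ => ![Algebra.norm ℚ x, Algebra.trace ℚ K x, 1]

/-- The square of `addSubMap` on coordinate vectors. -/
noncomputable def dupMap (t : Fin 3 → ℚ) : Fin 3 → ℚ :=
  fun i ↦ (addSubMap E i).eval fun j ↦ (addSubMap E j).eval t

lemma dupMap_ne_zero [E.IsElliptic] {t : Fin 3 → ℚ} (ht : t ≠ 0) : dupMap E t ≠ 0 :=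
  addSubMap_ne_zero E (addSubMap_ne_zero E ht)

lemma normTraceCoords_ne_zero (P : (E.baseChange K).toAffine.Point) :
    normTraceCoords E P ≠ 0 := by
  rcases P with _ | ⟨x, y, h⟩
  · exact fun h ↦ one_ne_zero (congrFun h 0)
  · exact fun h ↦ one_ne_zero (congrFun h 2)

lemma algebraMap_comp_dupMap (L : Type*) [Field L] [Algebra ℚ L] (t : Fin 3 → ℚ) :
    algebraMap ℚ L ∘ dupMap E t =
      fun i ↦ (addSubMap (E.baseChange L) i).eval fun j ↦
        (addSubMap (E.baseChange L) j).eval (algebraMap ℚ L ∘ t) := by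
  ext i
  fin_cases i <;> simp [dupMap, addSubMap, -eq_ratCast] <;>
    simp only [baseChange, map_b₂, map_b₄, map_b₆, map_b₈, map_ofNat]

lemma map_dupNum {L : Type*} [Field L] [Algebra ℚ L] (σ : K →ₐ[ℚ] L) (x : K) :
    σ ((E.baseChange K).dupNum x) = (E.baseChange L).dupNum (σ x) := by
  simp [dupNum, baseChange, map_ofNat σ]

lemma map_dupDen {L : Type*} [Field L] [Algebra ℚ L] (σ : K →ₐ[ℚ] L) (x : K) :
    σ ((E.baseChange K).dupDen x) = (E.baseChange L).dupDen (σ x) := by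
  simp [dupDen, baseChange, map_ofNat σ]

lemma exists_dupMap_normTraceCoords_eq [E.IsElliptic] [DecidableEq K] (hK : Module.finrank ℚ K = 2)
    (P : (E.baseChange K).toAffine.Point) :
    ∃ d : ℚ, d ≠ 0 ∧ dupMap E (normTraceCoords E P) = d • normTraceCoords E (P + P) := by
  have : FiniteDimensional ℚ K := .of_finrank_pos (by omega)
  obtain ⟨σ, τ, hστ⟩ := exists_pair_embeddings K hK
  have hne := dupMap_ne_zero E (normTraceCoords_ne_zero E P)
  have hinj : Function.Injective (algebraMap ℚ (AlgebraicClosure ℚ)) :=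
    (algebraMap ℚ (AlgebraicClosure ℚ)).injective
  rcases P with _ | ⟨x, y, h⟩
  · exact ⟨1, one_ne_zero, (addSubMap_addSubMap_zero E).trans (one_smul _ _).symm⟩
  have hdup : algebraMap ℚ (AlgebraicClosure ℚ) ∘ dupMap E (normTraceCoords E (.some x y h)) =
      let n := (E.baseChange K).dupNum x
      let d := (E.baseChange K).dupDen x
      ![σ n * τ n, σ n * τ d + σ d * τ n, σ d * τ d] := by
    simp only [map_dupNum, map_dupDen]
    rw [algebraMap_comp_dupMap, ← addSubMap_addSubMap_sym2]
    congr! with i j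
    ext k
    fin_cases k <;> simp [normTraceCoords, hστ, -eq_ratCast]
  -- If 2P = 0 the denominator vanishes and the scalar is the norm of the numerator, nonzero because
  -- `dupMap` kills no nonzero vector. Otherwise the scalar is the norm of the denominator.
  by_cases hy : y = (E.baseChange K).toAffine.negY x y
  · have hd : (E.baseChange K).dupDen x = 0 := by
      rw [dupDen_eq_sq h.1, sub_eq_zero.mpr hy, zero_pow two_ne_zero]
    have key : dupMap E (normTraceCoords E (.some x y h)) =
        Algebra.norm ℚ ((E.baseChange K).dupNum x) • ![1, 0, 0] := by
      refine hinj.comp_left ?_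
      simp only [Function.comp_def] at hdup ⊢
      rw [hdup]
      ext i
      fin_cases i <;> simp [hd, hστ, -eq_ratCast]
    refine ⟨Algebra.norm ℚ ((E.baseChange K).dupNum x), fun h0 ↦ hne ?_, ?_⟩
    · rw [key, h0, zero_smul]
    · rw [Affine.Point.add_self_of_Y_eq hy]
      exact key
  · have hd : (E.baseChange K).dupDen x ≠ 0 := by
      rw [dupDen_eq_sq h.1]
      exact pow_ne_zero _ (sub_ne_zero.mpr hy)
    refine ⟨Algebra.norm ℚ ((E.baseChange K).dupDen x), Algebra.norm_ne_zero_iff.mpr hd, ?_⟩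
    rw [Affine.Point.add_self_of_Y_ne hy]
    refine hinj.comp_left ?_
    simp only [Function.comp_def] at hdup ⊢
    rw [hdup, dupNum_eq_dupDen_mul_addX h.1 hy]
    simp only [normTraceCoords]
    generalize (E.baseChange K).toAffine.addX x x _ = X
    ext i
    fin_cases i <;> simp [hστ, -eq_ratCast] <;> ring

end SymmetricSquare

/-! ### Uniform height bound and Northcott finiteness. -/

section Heights

open Height

variable (E : WeierstrassCurve ℚ) [E.IsElliptic]

lemma exists_four_mul_logHeight_le_logHeight_dupMap :
    ∃ C, ∀ t : Fin 3 → ℚ, 4 * logHeight t ≤ logHeight (dupMap E t) + C := by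
  obtain ⟨C, hC⟩ := abs_logHeight_addSubMap_sub_two_mul_logHeight_le E
  -- The inner application loses C, doubled by the outer one, which loses a further C.
  refine ⟨3 * C, fun t ↦ ?_⟩
  have h1 := (abs_le.mp (hC t)).1
  have h2 := (abs_le.mp (hC fun j ↦ (addSubMap E j).eval t)).1
  unfold dupMap
  linarith

open Classical in
/-- The coordinates `normTraceCoords` of torsion points over quadratic fields have bounded height,
uniformly in the field. -/
lemma exists_logHeight_normTraceCoords_le :
    ∃ B, ∀ (K : IntermediateField ℚ (AlgebraicClosure ℚ)), Module.finrank ℚ K = 2 →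
      ∀ P ∈ AddCommGroup.torsion (E.baseChange K).toAffine.Point,
        logHeight (normTraceCoords E P) ≤ B := by
  obtain ⟨C, hC⟩ := exists_four_mul_logHeight_le_logHeight_dupMap E
  -- At a multiple Q of P of maximal height, 4h(Q) ≤ h(2Q) + C ≤ h(Q) + C.
  refine ⟨C / 3, fun K hK P hP ↦ ?_⟩
  have hfin : (AddSubgroup.zmultiples P : Set (E.baseChange K).toAffine.Point).Finite := by
    rw [finite_zmultiples]
    exact hP
  obtain ⟨Q, hQ, hmax⟩ := Set.exists_max_image _ (fun Q ↦ logHeight (normTraceCoords E Q)) hfin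
    ⟨P, AddSubgroup.mem_zmultiples P⟩
  obtain ⟨d, hd, h⟩ := exists_dupMap_normTraceCoords_eq E hK Q
  have h1 := hC (normTraceCoords E Q)
  rw [h, logHeight_smul_eq_logHeight _ hd] at h1
  have h2 := hmax (Q + Q) (add_mem hQ hQ)
  have h3 := hmax P (AddSubgroup.mem_zmultiples P)
  linarith

lemma finite_setOf_logHeight_le (B : ℝ) :
    {q : ℚ × ℚ | logHeight ![q.1, q.2, 1] ≤ B}.Finite := by
  have hfin := NumberField.finite_setOfPred_logHeight₁_le ℚ B
  refine (hfin.prod hfin).subset fun q hq ↦ ⟨?_, ?_⟩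
  -- Dropping a coordinate does not raise the height, so each entry has bounded height.
  · have := logHeight_comp_le ![(0 : Fin 3), 2] ![q.1, q.2, 1]
    refine le_trans ?_ (this.trans hq)
    rw [logHeight₁_eq_logHeight]
    apply le_of_eq
    congr 1
    ext i
    fin_cases i <;> rfl
  · have := logHeight_comp_le ![(1 : Fin 3), 2] ![q.1, q.2, 1]
    refine le_trans ?_ (this.trans hq)
    rw [logHeight₁_eq_logHeight]
    apply le_of_eq
    congr 1
    ext i
    fin_cases i <;> rfl

open Classical in
/-- Only finitely many pairs of algebraic numbers are the coordinates of a torsion point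
over a quadratic field. -/
lemma finite_setOf_torsion_coords :
    {p : AlgebraicClosure ℚ × AlgebraicClosure ℚ |
      ∃ (K : IntermediateField ℚ (AlgebraicClosure ℚ)) (x y : K)
        (h : (E.baseChange K).toAffine.Nonsingular x y), Module.finrank ℚ K = 2 ∧
          .some x y h ∈ AddCommGroup.torsion (E.baseChange K).toAffine.Point ∧
          p = (↑x, ↑y)}.Finite := by
  obtain ⟨B, hB⟩ := exists_logHeight_normTraceCoords_le E
  refine (finite_setOf_quadratic_weierstrass (E.baseChange (AlgebraicClosure ℚ)).toAffine _
    ((finite_setOf_logHeight_le B).image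
      (Prod.map (algebraMap ℚ _) (algebraMap ℚ _)))).subset ?_
  rintro _ ⟨K, x, y, h, hK, htors, rfl⟩
  refine ⟨⟨_, ⟨(Algebra.norm ℚ x, Algebra.trace ℚ K x), hB K hK _ htors, rfl⟩, ?_⟩, ?_⟩
  · have : FiniteDimensional ℚ K := .of_finrank_pos (by omega)
    obtain ⟨σ, τ, hστ⟩ := exists_pair_embeddings K hK
    -- The quadratic is (X − σx)(X − τx) after applying σ; rational x is covered as well.
    have hroot : (x : K) ^ 2 - algebraMap ℚ K (Algebra.trace ℚ K x) * x +
        algebraMap ℚ K (Algebra.norm ℚ x) = 0 := by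
      apply σ.injective
      change σ _ = σ _
      simp only [map_add, map_sub, map_mul, map_pow, AlgHom.commutes, hστ, map_zero]
      ring
    exact congrArg K.val hroot
  · exact (Affine.baseChange_equation E.toAffine (f := K.val) K.val.injective x y).mpr h.1

end Heights

/-! ### Recovering the field from an irrational torsion point. -/

section QuadraticFields

lemma _root_.IntermediateField.adjoin_eq_of_finrank_eq_two {F L : Type*} [Field F] [Field L]
    [Algebra F L] {K : IntermediateField F L} (hK : Module.finrank F K = 2) {S : Set L}
    (hS : S ⊆ K) {z : L} (hz : z ∈ S) (hbot : z ∉ (⊥ : IntermediateField F L)) :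
    IntermediateField.adjoin F S = K := by
  have : FiniteDimensional F K := .of_finrank_pos (by omega)
  have hle : IntermediateField.adjoin F S ≤ K := IntermediateField.adjoin_le_iff.mpr hS
  refine IntermediateField.eq_of_le_of_finrank_le hle ?_
  have : FiniteDimensional F (IntermediateField.adjoin F S) :=
    .of_injective (IntermediateField.inclusion hle).toLinearMap
      (IntermediateField.inclusion hle).injective
  have hpos : 0 < Module.finrank F (IntermediateField.adjoin F S) := Module.finrank_pos
  have hne : Module.finrank F (IntermediateField.adjoin F S) ≠ 1 := fun h ↦ by
    rw [IntermediateField.finrank_eq_one_iff] at h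
    exact hbot (h ▸ IntermediateField.subset_adjoin F S hz)
  omega

/-- If the torsion grows, there is a torsion point with an irrational coordinate. -/
lemma exists_torsion_not_rational (E : WeierstrassCurve ℚ) {K : Type*} [Field K] [Algebra ℚ K]
    [inst : DecidableEq K]
    (h : ¬ SameTorsion E K) :
    ∃ (x y : K) (hxy : (E.baseChange K).toAffine.Nonsingular x y),
      .some x y hxy ∈ AddCommGroup.torsion (E.baseChange K).toAffine.Point ∧
        ¬ (x ∈ (algebraMap ℚ K).range ∧ y ∈ (algebraMap ℚ K).range) := by
  -- `SameTorsion` is built on the classical decidability instance, so the group laws must be made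
  -- to agree.
  obtain rfl : inst = fun a b ↦ Classical.propDecidable (a = b) := Subsingleton.elim _ _
  classical
  contrapose! h
  refine le_antisymm (fun P hP ↦ ?_) ?_
  · rcases P with _ | ⟨x, y, hxy⟩
    · exact zero_mem _
    · obtain ⟨⟨x, rfl⟩, ⟨y, rfl⟩⟩ := h x y hxy hP
      have hxy' : (E.baseChange ℚ).toAffine.Nonsingular x y :=
        (Affine.baseChange_nonsingular E.toAffine (f := Algebra.ofId ℚ K) (Algebra.ofId ℚ K).injective x y).mp hxy
      refine ⟨.some x y hxy', ?_, rfl⟩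
      exact (Affine.Point.map_injective (W' := E.toAffine)
        (f := Algebra.ofId ℚ K)).isOfFinAddOrder_iff.mp hP
  · rintro _ ⟨P, hP, rfl⟩
    exact AddMonoidHom.isOfFinAddOrder _ hP

end QuadraticFields

end WeierstrassCurve

/-- For an elliptic curve `E` over `ℚ`, `E(K)_tors = E(ℚ)_tors` for all but finitely many quadratic
fields `K`. Quadratic fields are taken as subfields of a fixed algebraic closure of `ℚ`. -/
theorem theorem6 (E : WeierstrassCurve ℚ) [E.IsElliptic] :
    {K : IntermediateField ℚ (AlgebraicClosure ℚ) |
      Module.finrank ℚ K = 2 ∧ ¬ SameTorsion E K}.Finite := by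
  classical
  refine ((WeierstrassCurve.finite_setOf_torsion_coords E).image fun p ↦
    IntermediateField.adjoin ℚ {p.1, p.2}).subset ?_
  rintro K ⟨hK, hE⟩
  obtain ⟨x, y, hxy, htors, hnot⟩ := WeierstrassCurve.exists_torsion_not_rational E hE
  refine ⟨(↑x, ↑y), ⟨K, x, y, hxy, hK, htors, rfl⟩, ?_⟩
  have hS : ({(x : AlgebraicClosure ℚ), (y : AlgebraicClosure ℚ)} : Set _) ⊆ K := by
    rintro _ (rfl | rfl)
    exacts [x.2, y.2]
  have hbot (z : K) (hz : z ∉ (algebraMap ℚ K).range) :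
      (z : AlgebraicClosure ℚ) ∉ (⊥ : IntermediateField ℚ (AlgebraicClosure ℚ)) := by
    rw [IntermediateField.mem_bot]
    rintro ⟨q, hq⟩
    exact hz ⟨q, Subtype.ext hq⟩
  rcases not_and_or.mp hnot with h | h
  · exact IntermediateField.adjoin_eq_of_finrank_eq_two hK hS (Set.mem_insert _ _) (hbot x h)
  · exact IntermediateField.adjoin_eq_of_finrank_eq_two hK hS (Set.mem_insert_of_mem _ rfl)
      (hbot y h)
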